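/- Call a group $H$ an \emph{integral} of a group $G$ if the derived group (commutator subgroup) $H'$ of $H$ is isomorphic to $G$, and call $G$ \emph{integrable} if it has an integral. Write $C_m$ for the cyclic group of order $m$. (a) Every abelian group $A$ (finite or infinite) is integrable. More precisely, the derived group of the wreath product $A\wr C_2 = (A\times A)\rtimes C_2$, where $C_2$ interchanges the two factors, is isomorphic to $A$. (b) Every free group is integrable. More precisely, a free group of infinite rank is isomorphic to its own derived group; and for every integer $n\ge 0$, the free group $F_n$ of rank $n$ is isomorphic to the derived group of the free product $C_2 * C_{n+1}$. -/

import Mathlib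

universe u v w

/-- The group `H` is an *integral* of the group `G` if the derived group (commutator subgroup)
of `H` is isomorphic to `G`. -/
def IsGroupIntegral (H : Type v) [Group H] (G : Type u) [Group G] : Prop :=
  Nonempty (commutator H ≃* G)

/-- A group is *integrable* if it has an integral. -/
def IsIntegrableGroup (G : Type u) [Group G] : Prop :=
  ∃ (H : Type u) (_ : Group H), IsGroupIntegral H G

/-- The cyclic group of order `n` (for `n` positive), written multiplicatively. -/
abbrev CyclicGroup (n : ℕ) : Type := Multiplicative (ZMod n)

open scoped commutatorElement

/-! In `A ≀ C₂`, commutators of `(a, 1)` with the swap give all `(a, a⁻¹)`. Conversely the map to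
the abelian group `A × C₂` multiplying the two coordinates kills the derived group, and its kernel
is this antidiagonal.

A derived group of a free group is free by Nielsen–Schreier, so in infinite rank only the ranks need
comparing, and these are cardinalities.

For `A`, `B` abelian, the derived group of `A * B` is free on the commutators of nontrivial `a`,
`b`. Independence follows from an action of `A * B` on normal forms; `C₂` and `Cₙ₊₁` give `1 * n`
generators. -/

/-- Isomorphic groups have isomorphic derived groups. -/
theorem nonempty_commutator_mulEquiv {G : Type u} {H : Type v} [Group G] [Group H] (e : G ≃* H) :
    Nonempty (commutator G ≃* commutator H) := by
  have h : (commutator G).map e.toMonoidHom = commutator H := by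
    rw [commutator_def, commutator_def, Subgroup.map_commutator, ← MonoidHom.range_eq_map,
      MonoidHom.range_eq_top.2 e.surjective]
  exact ⟨(e.subgroupMap _).trans (MulEquiv.subgroupCongr h)⟩

theorem IsGroupIntegral.congr {G : Type u} {G' : Type v} {H : Type w} {H' : Type*}
    [Group G] [Group G'] [Group H] [Group H'] (h : IsGroupIntegral H G) (e : H ≃* H')
    (f : G ≃* G') : IsGroupIntegral H' G' := by
  obtain ⟨φ⟩ := h
  obtain ⟨ψ⟩ := nonempty_commutator_mulEquiv e
  exact ⟨(ψ.symm.trans φ).trans f⟩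

section Wreath

variable {A : Type u} [CommGroup A]

theorem CyclicGroup.eq_one_or_eq_ofAdd_one (x : CyclicGroup 2) :
    x = 1 ∨ x = Multiplicative.ofAdd 1 := by
  revert x; decide

/-- The embedding `a ↦ (a, a⁻¹)` of `A` into the base group of `A ≀ C₂`. -/
def antidiagonal (A : Type u) [CommGroup A] : A →* RegularWreathProduct A (CyclicGroup 2) where
  toFun a := ⟨fun x ↦ if x = 1 then a else a⁻¹, 1⟩
  map_one' := by ext <;> simp
  map_mul' a b := by
    ext x
    · by_cases h : x = 1 <;> simp [h, mul_comm]
    · simp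

theorem antidiagonal_injective : Function.Injective (antidiagonal A) := fun a b h ↦ by
  simpa [antidiagonal] using congrFun (congrArg RegularWreathProduct.left h) 1

/-- The homomorphism `A ≀ C₂ → A × C₂` sending `((a, b), c)` to `(a * b, c)`. -/
def baseProd (A : Type u) [CommGroup A] :
    RegularWreathProduct A (CyclicGroup 2) →* A × CyclicGroup 2 where
  toFun w := (w.left 1 * w.left (Multiplicative.ofAdd 1), w.right)
  map_one' := by simp
  map_mul' v w := by
    have h : (Multiplicative.ofAdd 1 : CyclicGroup 2)⁻¹ = Multiplicative.ofAdd 1 := by decide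
    have h' : (Multiplicative.ofAdd 1 * Multiplicative.ofAdd 1 : CyclicGroup 2) = 1 := by decide
    rcases CyclicGroup.eq_one_or_eq_ofAdd_one v.right with hv | hv
    · simp [hv, mul_mul_mul_comm]
    · simp only [RegularWreathProduct.mul_left, RegularWreathProduct.mul_right, hv, h, h',
        Pi.mul_apply, mul_one, Prod.mk_mul_mk]
      rw [mul_mul_mul_comm, mul_comm (w.left (Multiplicative.ofAdd 1))]

theorem range_antidiagonal : (antidiagonal A).range = commutator _ := by
  apply le_antisymm
  · rintro _ ⟨a, rfl⟩
    have h : antidiagonal A a = ⁅(⟨fun x ↦ if x = 1 then a else 1, 1⟩ :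
        RegularWreathProduct A (CyclicGroup 2)), ⟨1, Multiplicative.ofAdd 1⟩⁆ := by
      rw [commutatorElement_def]
      ext x
      · rcases CyclicGroup.eq_one_or_eq_ofAdd_one x with rfl | rfl <;>
          simp [antidiagonal]
      · simp [antidiagonal]
    rw [h, commutator_def]
    exact Subgroup.commutator_mem_commutator trivial trivial
  · intro w hw
    have h := Abelianization.commutator_subset_ker (baseProd A) hw
    obtain ⟨h₁, h₂⟩ := Prod.ext_iff.1 (MonoidHom.mem_ker.1 h)
    refine ⟨w.left 1, ?_⟩
    ext x
    · rcases CyclicGroup.eq_one_or_eq_ofAdd_one x with rfl | rfl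
      · simp [antidiagonal]
      · simpa [antidiagonal] using (eq_inv_of_mul_eq_one_right h₁).symm
    · exact congrArg _ h₂.symm

/-- The derived group of `A ≀ C₂` is isomorphic to `A`. -/
theorem isGroupIntegral_wreath (A : Type u) [CommGroup A] :
    IsGroupIntegral (RegularWreathProduct A (CyclicGroup 2)) A :=
  ⟨((MonoidHom.ofInjective antidiagonal_injective).trans
    (MulEquiv.subgroupCongr range_antidiagonal)).symm⟩

end Wreath

section InfiniteRank

open FreeGroup Cardinal

theorem commutator_swap_fin_three_ne :
    ⁅(Equiv.swap 0 1 : Equiv.Perm (Fin 3)), (Equiv.swap 1 2 : Equiv.Perm (Fin 3))⁆ ≠ 1 := by decide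

/-- The homomorphism to the symmetric group on three letters which sends the generators `none` and
`some j` to two transpositions and kills the remaining generators. -/
noncomputable def twoLetterHom {ι : Type u} (j : ι) :
    FreeGroup (Option ι) →* Equiv.Perm (Fin 3) :=
  open Classical in
  FreeGroup.lift fun o ↦ o.elim (Equiv.swap 0 1) fun i ↦ if i = j then Equiv.swap 1 2 else 1

/-- The commutators of the generator `none` with the other generators. -/
def noneCommutator {ι : Type u} (i : ι) : commutator (FreeGroup (Option ι)) :=
  ⟨⁅of none, of (some i)⁆, Subgroup.commutator_mem_commutator trivial trivial⟩

/-- The two transpositions do not commute, so `twoLetterHom j` detects exactly the `j`-th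
commutator. -/
theorem twoLetterHom_noneCommutator_eq_one_iff {ι : Type u} (i j : ι) :
    twoLetterHom j (noneCommutator i : FreeGroup (Option ι)) = 1 ↔ i ≠ j := by
  by_cases h : i = j
  · simpa [noneCommutator, twoLetterHom, map_commutatorElement, h] using commutator_swap_fin_three_ne
  · simp [noneCommutator, twoLetterHom, map_commutatorElement, h]

theorem noneCommutator_injective {ι : Type u} : Function.Injective (noneCommutator (ι := ι)) := by
  intro i j h
  by_contra hij
  have := (twoLetterHom_noneCommutator_eq_one_iff i j).2 hij
  rw [h, twoLetterHom_noneCommutator_eq_one_iff] at this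
  exact this rfl

/-- A free basis of the derived group of a free group of infinite rank is infinite. -/
theorem infinite_of_basis_commutator {ι : Type u} {κ : Type v} [Infinite ι]
    (b : FreeGroupBasis κ (commutator (FreeGroup (Option ι)))) : Infinite κ := by
  by_contra hκ
  rw [not_infinite_iff_finite] at hκ
  have : Finite (commutator (FreeGroup (Option ι)) →* Equiv.Perm (Fin 3)) :=
    Finite.of_equiv _ b.lift
  -- A finite basis allows only finitely many homomorphisms to `S₃`, yet these restrictions are
  -- pairwise distinct.
  refine not_injective_infinite_finite
    (fun j : ι ↦ (twoLetterHom j).comp (commutator (FreeGroup (Option ι))).subtype) ?_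
  intro i j h
  by_contra hij
  have h₁ := (twoLetterHom_noneCommutator_eq_one_iff i j).2 hij
  have h₂ := DFunLike.congr_fun h (noneCommutator i)
  exact (twoLetterHom_noneCommutator_eq_one_iff i i).1 (h₂.trans h₁) rfl

theorem isGroupIntegral_freeGroup_option (ι : Type u) [Infinite ι] :
    IsGroupIntegral (FreeGroup (Option ι)) (FreeGroup (Option ι)) := by
  obtain ⟨κ, ⟨b⟩⟩ :=
    IsFreeGroup.nonempty_basis (G := commutator (FreeGroup (Option ι)))
  have hκ := infinite_of_basis_commutator b
  have h₁ : #κ = #(commutator (FreeGroup (Option ι))) := by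
    rw [mk_congr b.repr.toEquiv, mk_freeGroup, max_eq_left (aleph0_le_mk κ)]
  have h₂ : #(Option ι) = #ι := by
    rw [mk_option, add_one_eq (aleph0_le_mk ι)]
  have h₃ : #(FreeGroup (Option ι)) = #(Option ι) := by
    rw [mk_freeGroup, max_eq_left (aleph0_le_mk _)]
  have h : #κ = #(Option ι) := by
    rw [h₁]
    exact le_antisymm (h₃ ▸ mk_subtype_le _) (h₂ ▸ mk_le_of_injective noneCommutator_injective)
  obtain ⟨e⟩ := Cardinal.eq.1 h
  exact ⟨b.repr.trans (freeGroupCongr e)⟩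

/-- A free group of infinite rank is isomorphic to its own derived group. -/
theorem isGroupIntegral_self {G : Type u} [Group G] {ι : Type w} [Infinite ι]
    (b : FreeGroupBasis ι G) : IsGroupIntegral G G := by
  obtain ⟨e⟩ : Nonempty (Option ι ≃ ι) := Cardinal.eq.1 <| by
    rw [mk_option, add_one_eq (aleph0_le_mk ι)]
  have f := (freeGroupCongr e).trans b.repr.symm
  exact (isGroupIntegral_freeGroup_option ι).congr f f

end InfiniteRank

namespace Monoid.Coprod

variable {A : Type u} {B : Type v} [CommGroup A] [CommGroup B]

/-- The pairs of nontrivial elements of `A` and `B`. -/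
abbrev NontrivialPair (A : Type u) (B : Type v) [CommGroup A] [CommGroup B] :=
  {p : A × B // p.1 ≠ 1 ∧ p.2 ≠ 1}

/-- The homomorphism sending the free generator `(a, b)` to `⁅a⁻¹, b⁻¹⁆` in `A * B`. -/
def ofPairs (A : Type u) (B : Type v) [CommGroup A] [CommGroup B] :
    FreeGroup (NontrivialPair A B) →* Monoid.Coprod A B :=
  FreeGroup.lift fun p ↦ ⁅(inl p.1.1 : Monoid.Coprod A B)⁻¹, (inr p.1.2 : Monoid.Coprod A B)⁻¹⁆

/-- The free generator attached to `(a, b)`, or `1` if `a` or `b` is trivial. -/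
noncomputable def pairGen (a : A) (b : B) : FreeGroup (NontrivialPair A B) :=
  open Classical in
  if h : a ≠ 1 ∧ b ≠ 1 then FreeGroup.of ⟨(a, b), h⟩ else 1

@[simp] theorem pairGen_one_left (b : B) : pairGen (1 : A) b = 1 := by simp [pairGen]

@[simp] theorem pairGen_one_right (a : A) : pairGen a (1 : B) = 1 := by simp [pairGen]

theorem pairGen_coe (p : NontrivialPair A B) : pairGen p.1.1 p.1.2 = FreeGroup.of p := by
  simp [pairGen, p.2.1, p.2.2]

theorem ofPairs_pairGen (a : A) (b : B) :
    ofPairs A B (pairGen a b) = (inl a)⁻¹ * (inr b)⁻¹ * inl a * inr b := by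
  by_cases ha : a = 1
  · simp [ha]
  by_cases hb : b = 1
  · simp [hb]
  · simp [ofPairs, pairGen, ha, hb, commutatorElement_def]

/-- Left multiplication on `A * B`, written in the coordinates given by
`(b, a, f) ↦ b * a * ofPairs f`. -/
noncomputable def coordAction (A : Type u) (B : Type v) [CommGroup A] [CommGroup B] :
    Monoid.Coprod A B →* Function.End (B × A × FreeGroup (NontrivialPair A B)) :=
  lift
    -- With `pairGen a b` read as `a⁻¹b⁻¹ab`, moving a left factor past `b` costs this quotient,
    -- which telescopes under composition.
    { toFun a x := (x.1, a * x.2.1, pairGen (a * x.2.1) x.1 * (pairGen x.2.1 x.1)⁻¹ * x.2.2)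
      map_one' := by funext x; simp; rfl
      map_mul' a a' := by
        funext x
        change _ = (_, a * (a' * x.2.1), _ * (_ * _ * x.2.2))
        simp [mul_assoc] }
    { toFun b x := (b * x.1, x.2)
      map_one' := by funext x; simp; rfl
      map_mul' b b' := by funext x; exact congrArg (·, x.2) (mul_assoc b b' x.1) }

theorem coordAction_inl (a : A) (x : B × A × FreeGroup (NontrivialPair A B)) :
    coordAction A B (inl a) x =
      (x.1, a * x.2.1, pairGen (a * x.2.1) x.1 * (pairGen x.2.1 x.1)⁻¹ * x.2.2) := rfl

theorem coordAction_inr (b : B) (x : B × A × FreeGroup (NontrivialPair A B)) :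
    coordAction A B (inr b) x = (b * x.1, x.2) := rfl

theorem coordAction_mul (g h : Monoid.Coprod A B) (x : B × A × FreeGroup (NontrivialPair A B)) :
    coordAction A B (g * h) x = coordAction A B g (coordAction A B h x) := by
  rw [map_mul]; rfl

/-- The element of `A * B` with given coordinates. -/
def ofCoord (x : B × A × FreeGroup (NontrivialPair A B)) : Monoid.Coprod A B :=
  inr x.1 * inl x.2.1 * ofPairs A B x.2.2

/-- Equivariance makes `ofCoord` surjective: the orbit of `(1, 1, 1)` provides coordinates for every
`g`. -/
theorem ofCoord_coordAction (g : Monoid.Coprod A B)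
    (x : B × A × FreeGroup (NontrivialPair A B)) :
    ofCoord (coordAction A B g x) = g * ofCoord x := by
  induction g using Monoid.Coprod.induction_on generalizing x with
  | inl a =>
    simp only [coordAction_inl, ofCoord, map_mul, map_inv, ofPairs_pairGen]
    group
  | inr b => simp [coordAction_inr, ofCoord, mul_assoc]
  | mul g h hg hh => rw [coordAction_mul, hg, hh, mul_assoc]

theorem coordAction_base (g : Monoid.Coprod A B)
    (x : B × A × FreeGroup (NontrivialPair A B)) :
    (coordAction A B g x).1 = snd g * x.1 ∧ (coordAction A B g x).2.1 = fst g * x.2.1 := by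
  induction g using Monoid.Coprod.induction_on generalizing x with
  | inl a => simp [coordAction_inl]
  | inr b => simp [coordAction_inr]
  | mul g h hg hh => simp [coordAction_mul, hg, hh, mul_assoc]

theorem coordAction_inv_of_eq {g : Monoid.Coprod A B}
    {x y : B × A × FreeGroup (NontrivialPair A B)} (h : coordAction A B g x = y) :
    coordAction A B g⁻¹ y = x := by
  rw [← h, ← coordAction_mul, inv_mul_cancel, map_one]; rfl

theorem coordAction_ofPairs (f f' : FreeGroup (NontrivialPair A B)) :
    coordAction A B (ofPairs A B f) (1, 1, f') = (1, 1, f * f') := by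
  induction f using FreeGroup.induction_on generalizing f' with
  | C1 => rw [map_one, map_one, one_mul]; rfl
  | of p =>
    rw [← pairGen_coe, ofPairs_pairGen, ← map_inv (inl : A →* Monoid.Coprod A B), ← map_inv (inr : B →* Monoid.Coprod A B)]
    simp only [coordAction_mul, coordAction_inl, coordAction_inr]
    simp
  | inv_of p ih =>
    rw [map_inv]
    apply coordAction_inv_of_eq
    rw [ih, mul_inv_cancel_left]
  | mul f g hf hg => rw [map_mul, coordAction_mul, hg, hf, mul_assoc]

/-- Acting on the base point recovers the word `f`. -/
theorem ofPairs_injective : Function.Injective (ofPairs A B) := fun f f' h ↦ by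
  simpa [coordAction_ofPairs] using
    congrArg (fun g ↦ coordAction A B g ((1 : B), (1 : A), 1)) h

theorem range_ofPairs : (ofPairs A B).range = commutator (Monoid.Coprod A B) := by
  apply le_antisymm
  · rw [ofPairs, FreeGroup.range_lift_eq_closure, Subgroup.closure_le]
    rintro _ ⟨p, rfl⟩
    exact Subgroup.commutator_mem_commutator trivial trivial
  · intro g hg
    have h₁ : fst g = 1 := Abelianization.commutator_subset_ker (fst : Monoid.Coprod A B →* A) hg
    have h₂ : snd g = 1 := Abelianization.commutator_subset_ker (snd : Monoid.Coprod A B →* B) hg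
    have h := ofCoord_coordAction g (1, 1, 1)
    obtain ⟨h₃, h₄⟩ := coordAction_base g (1, 1, 1)
    refine ⟨(coordAction A B g (1, 1, 1)).2.2, ?_⟩
    -- The `A` and `B` coordinates of `g` are its projections, which vanish on commutators, so only
    -- the free part remains.
    simpa [ofCoord, h₃, h₄, h₁, h₂] using h

/-- The derived group of the free product of two abelian groups `A` and `B` is free on the pairs
of nontrivial elements of `A` and `B`. -/
theorem isGroupIntegral_freeGroup (A : Type u) (B : Type v) [CommGroup A] [CommGroup B] :
    IsGroupIntegral (Monoid.Coprod A B) (FreeGroup (NontrivialPair A B)) :=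
  ⟨((MonoidHom.ofInjective ofPairs_injective).trans (MulEquiv.subgroupCongr range_ofPairs)).symm⟩

theorem card_nontrivialPair_cyclicGroup (n : ℕ) :
    Nat.card (NontrivialPair (CyclicGroup 2) (CyclicGroup (n + 1))) = n := by
  have e : NontrivialPair (CyclicGroup 2) (CyclicGroup (n + 1)) ≃
      {a : CyclicGroup 2 // a ≠ 1} × {b : CyclicGroup (n + 1) // b ≠ 1} :=
    Equiv.subtypeProdEquivProd (p := fun a : CyclicGroup 2 ↦ a ≠ 1)
      (q := fun b : CyclicGroup (n + 1) ↦ b ≠ 1)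
  have h (m : ℕ) [NeZero m] : Nat.card {b : CyclicGroup m // b ≠ 1} = m - 1 := by
    classical
    rw [Nat.card_eq_fintype_card, Fintype.card_subtype_compl, Fintype.card_subtype_eq,
      Fintype.card_multiplicative, ZMod.card]
  rw [Nat.card_congr e, Nat.card_prod, h, h]
  simp

/-- A free group of rank `n` is isomorphic to the derived group of `C₂ * Cₙ₊₁`. -/
theorem isGroupIntegral_cyclicGroup {G : Type u} [Group G] {n : ℕ}
    (b : FreeGroupBasis (Fin n) G) :
    IsGroupIntegral (Monoid.Coprod (CyclicGroup 2) (CyclicGroup (n + 1))) G := by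
  have e : NontrivialPair (CyclicGroup 2) (CyclicGroup (n + 1)) ≃ Fin n :=
    Finite.equivFinOfCardEq (card_nontrivialPair_cyclicGroup n)
  exact (isGroupIntegral_freeGroup _ _).congr (MulEquiv.refl _)
    ((FreeGroup.freeGroupCongr e).trans b.repr.symm)

end Monoid.Coprod

theorem IsFreeGroup.isIntegrableGroup (G : Type u) [Group G] [IsFreeGroup G] :
    IsIntegrableGroup G := by
  obtain ⟨ι, ⟨b⟩⟩ := IsFreeGroup.nonempty_basis (G := G)
  rcases finite_or_infinite ι with hι | hι
  · obtain ⟨n, ⟨e⟩⟩ := Finite.exists_equiv_fin ι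
    -- The integral must live in the universe of `G`.
    exact ⟨ULift (Monoid.Coprod (CyclicGroup 2) (CyclicGroup (n + 1))), inferInstance,
      (Monoid.Coprod.isGroupIntegral_cyclicGroup (b.reindex e)).congr MulEquiv.ulift.symm
        (MulEquiv.refl G)⟩
  · exact ⟨G, inferInstance, isGroupIntegral_self b⟩

theorem mainTheorem10 :
    -- every abelian group is integrable, and `A ≀ C₂` is an integral of `A`
    (∀ (A : Type u) [CommGroup A],
      IsIntegrableGroup A ∧ IsGroupIntegral (RegularWreathProduct A (CyclicGroup 2)) A) ∧
    -- every free group is integrable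
    (∀ (G : Type u) [Group G] [IsFreeGroup G], IsIntegrableGroup G) ∧
    -- a free group of infinite rank is isomorphic to its own derived group
    (∀ (G : Type u) [Group G] (ι : Type w) [Infinite ι] (_ : FreeGroupBasis ι G),
      IsGroupIntegral G G) ∧
    -- a free group of finite rank `n` is isomorphic to the derived group of `C₂ * Cₙ₊₁`
    (∀ (G : Type u) [Group G] (n : ℕ) (_ : FreeGroupBasis (Fin n) G),
      IsGroupIntegral (Monoid.Coprod (CyclicGroup 2) (CyclicGroup (n + 1))) G) := by
  exact ⟨fun A _ ↦ ⟨⟨_, _, isGroupIntegral_wreath A⟩, isGroupIntegral_wreath A⟩,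
    fun G _ _ ↦ IsFreeGroup.isIntegrableGroup G, fun G _ ι _ b ↦ isGroupIntegral_self b,
    fun G _ n b ↦ Monoid.Coprod.isGroupIntegral_cyclicGroup b⟩
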